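/- Let $n\ge 3$ and let $\mathcal G=(\mathcal V,\mathcal E)$ be an undirected simple graph with vertex set $\mathcal V=\{1,\dots,n\}$. A framework $(\mathcal G,p)$ is given by a configuration $p=(p_1,\dots,p_n)\in(\mathbb R^2)^n$ with pairwise distinct points. For adjacent $i,j$ put $b_{ji}=\frac{p_i-p_j}{\|p_i-p_j\|}$, and for $(i,j,k)$ in $\mathcal T_{\mathcal G}=\{(i,j,k)\in\mathcal V^3:(j,i),(j,k)\in\mathcal E,\ i<k\}$ let $\alpha_{ijk}(p)\in[0,2\pi)$ be the counter-clockwise angle from $b_{ji}$ to $b_{jk}$. A vector $v\in(\mathbb R^2)^n$ is an infinitesimal signed angle motion of $(\mathcal G,p)$ if for every $(i,j,k)\in\mathcal T_{\mathcal G}$ the derivative at $p$ of $\alpha_{ijk}$, understood as an angle modulo $2\pi$, vanishes in the direction $v$. It is trivial if it lies in the linear span of the uniform scaling $(p_i)_i$, the uniform rotation $(p_i^{\perp})_i$, where $x^\perp$ is $x$ rotated counter-clockwise by $\pi/2$, and the uniform translations $((1,0))_i$, $((0,1))_i$. The framework is infinitesimally signed angle rigid (ISAR) if all its infinitesimal signed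 angle motions are trivial, and the graph $\mathcal G$ is ISAR if $(\mathcal G,p)$ is ISAR for at least one configuration $p$ with pairwise distinct points. A Laman graph is a graph with $m\ge 3$ vertices and exactly $2m-3$ edges such that every subgraph with $v\ge 2$ vertices has at most $2v-3$ edges. A spanning subgraph of $\mathcal G$ is a connected subgraph whose vertex set is $\mathcal V$. Theorem. The graph $\mathcal G$ is ISAR if and only if it contains a spanning subgraph that is a Laman graph. -/

import Mathlib

noncomputable section

namespace SignedAngle

/-- The Euclidean plane. -/
abbrev Plane : Type := EuclideanSpace ℝ (Fin 2)

/-- Tuples `(p_1, …, p_n)` of points (or of velocities) in the plane. -/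
abbrev Config (n : ℕ) : Type := Fin n → Plane

/-- `x^⊥`: the vector `x` rotated counter-clockwise by `π / 2`. -/
def perp (x : Plane) : Plane := !₂[-x 1, x 0]

/-- The bearing `b_{ji} = (p_i - p_j) / ‖p_i - p_j‖` from `p_j` to `p_i`. -/
def bearing {n : ℕ} (p : Config n) (j i : Fin n) : Plane := ‖p i - p j‖⁻¹ • (p i - p j)

/-- The signed angle `α_{ijk} ∈ [0, 2π)` from `b_{ji}` to `b_{jk}`, counter-clockwise. -/
def signedAngle {n : ℕ} (p : Config n) (i j k : Fin n) : ℝ :=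
  if 0 ≤ inner ℝ (bearing p j k) (perp (bearing p j i)) then
    Real.arccos (inner ℝ (bearing p j k) (bearing p j i))
  else
    2 * Real.pi - Real.arccos (inner ℝ (bearing p j k) (bearing p j i))

/-- The index set `T_G` of all signed angles of a graph. -/
def angleIndexSet {n : ℕ} (G : SimpleGraph (Fin n)) : Set (Fin n × Fin n × Fin n) :=
  {τ | G.Adj τ.2.1 τ.1 ∧ G.Adj τ.2.1 τ.2.2 ∧ τ.1 < τ.2.2}

/-- The change `α_{ijk}(q) - α_{ijk}(p)` of a signed angle, an angle being understood modulo
`2π`: the representative in `(-π, π]` is taken. For `q` near `p` it is a smooth function of `q`,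
also where the representative of the angle itself in `[0, 2π)` jumps (at angle `0`). -/
def angleChange {n : ℕ} (p : Config n) (i j k : Fin n) (q : Config n) : ℝ :=
  ((signedAngle q i j k - signedAngle p i j k : ℝ) : Real.Angle).toReal

/-- The signed angle rigidity matrix at `p` as a linear map: the row of `τ = (i, j, k)` is the
derivative at `p` of the signed angle `α_{ijk}` with respect to the configuration. -/
def rigidityMatrix {n : ℕ} (G : SimpleGraph (Fin n)) (p : Config n) :
    Config n →ₗ[ℝ] (angleIndexSet G → ℝ) :=
  LinearMap.pi fun τ =>
    (fderiv ℝ (angleChange p τ.1.1 τ.1.2.1 τ.1.2.2) p).toLinearMap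

/-- Infinitesimal signed angle motions of the framework `(G, p)`: the derivative of the signed
angle rigidity function vanishes along `v`. -/
def IsInfinitesimalMotion {n : ℕ} (G : SimpleGraph (Fin n)) (p v : Config n) : Prop :=
  rigidityMatrix G p v = 0

/-- Trivial motions: spanned by the uniform scaling, the uniform rotation and the uniform
translations of the configuration. -/
def trivialMotions {n : ℕ} (p : Config n) : Submodule ℝ (Config n) :=
  Submodule.span ℝ {p} ⊔ Submodule.span ℝ {fun i => perp (p i)} ⊔
    Submodule.span ℝ {fun _ => !₂[1, 0], fun _ => !₂[0, 1]}

/-- The framework `(G, p)` is infinitesimally signed angle rigid. -/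
def FrameworkISAR {n : ℕ} (G : SimpleGraph (Fin n)) (p : Config n) : Prop :=
  ∀ v : Config n, IsInfinitesimalMotion G p v → v ∈ trivialMotions p

/-- A graph is infinitesimally signed angle rigid if some framework on it is; the points of a
framework are pairwise distinct. -/
def GraphISAR {n : ℕ} (G : SimpleGraph (Fin n)) : Prop :=
  ∃ p : Config n, Function.Injective p ∧ FrameworkISAR G p

/-- Laman graphs: at least three vertices, `2 |V| - 3` edges, and every subgraph with
`v ≥ 2` vertices has at most `2 v - 3` edges. -/
def IsLaman {V : Type*} [Fintype V] (L : SimpleGraph V) : Prop :=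
  3 ≤ Fintype.card V ∧
    L.edgeSet.ncard + 3 = 2 * Fintype.card V ∧
    ∀ H : L.Subgraph, 2 ≤ H.verts.ncard → H.edgeSet.ncard + 3 ≤ 2 * H.verts.ncard

/-- `L` is a spanning subgraph of `G`: connected, on the same vertices, with edges in `G`. -/
def IsSpanningSubgraph {V : Type*} (L G : SimpleGraph V) : Prop :=
  L ≤ G ∧ L.Connected

/-! The derivative of a signed angle in closed form; in particular the derivative in
`rigidityMatrix` exists at every framework. -/

/-- The plane as the complex numbers. -/
def toC : Plane →L[ℝ] ℂ :=
  LinearMap.toContinuousLinearMap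
    { toFun := fun x => ⟨x 0, x 1⟩
      map_add' := fun x y => by apply Complex.ext <;> simp
      map_smul' := fun c x => by apply Complex.ext <;> simp }

theorem toC_apply (x : Plane) : toC x = ⟨x 0, x 1⟩ := rfl

theorem norm_toC (x : Plane) : ‖toC x‖ = ‖x‖ := by
  rw [EuclideanSpace.norm_eq, toC_apply, Complex.norm_def, Complex.normSq_mk]
  simp [sq]

theorem toC_ne_zero {x : Plane} (hx : x ≠ 0) : toC x ≠ 0 := by
  rw [← norm_ne_zero_iff, norm_toC]
  exact norm_ne_zero_iff.mpr hx

theorem inner_eq (x y : Plane) : inner ℝ x y = x 0 * y 0 + x 1 * y 1 := by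
  simp [PiLp.inner_apply, Fin.sum_univ_two, mul_comm]

theorem signedAngle_coe {n : ℕ} {p : Config n} {i j k : Fin n} (hi : p i ≠ p j)
    (hk : p k ≠ p j) : (signedAngle p i j k : Real.Angle) =
      ((toC (p k - p j) * (starRingEnd ℂ) (toC (p i - p j))).arg : Real.Angle) := by
  have hu := toC_ne_zero (sub_ne_zero.mpr hi)
  have hw := toC_ne_zero (sub_ne_zero.mpr hk)
  have hu' : 0 < ‖p i - p j‖ := norm_pos_iff.mpr (sub_ne_zero.mpr hi)
  have hw' : 0 < ‖p k - p j‖ := norm_pos_iff.mpr (sub_ne_zero.mpr hk)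
  set u := p i - p j with hu_def
  set w := p k - p j with hw_def
  set Z : ℂ := toC w * (starRingEnd ℂ) (toC u) with hZ
  have hZ0 : Z ≠ 0 := mul_ne_zero hw ((map_ne_zero _).mpr hu)
  have hnorm : ‖Z‖ = ‖w‖ * ‖u‖ := by
    rw [hZ, norm_mul, RCLike.norm_conj, norm_toC, norm_toC]
  have hre : inner ℝ (bearing p j k) (bearing p j i) = Z.re / ‖Z‖ := by
    rw [hnorm, hZ]
    simp only [bearing, ← hu_def, ← hw_def, inner_eq, toC_apply, Complex.mul_re,
      Complex.conj_re, Complex.conj_im, PiLp.smul_apply, smul_eq_mul]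
    field_simp
    try ring
  have him : inner ℝ (bearing p j k) (perp (bearing p j i)) = Z.im / ‖Z‖ := by
    rw [hnorm, hZ]
    simp only [bearing, perp, ← hu_def, ← hw_def, inner_eq, toC_apply, Complex.mul_im,
      Complex.conj_re, Complex.conj_im, PiLp.smul_apply, smul_eq_mul, Matrix.cons_val_zero,
      Matrix.cons_val_one]
    field_simp
    try ring
  have hZn : 0 < ‖Z‖ := norm_pos_iff.mpr hZ0
  unfold signedAngle
  rw [hre, him]
  split_ifs with h
  · rw [Complex.arg_of_im_nonneg_of_ne_zero _ hZ0]
    have := mul_nonneg h hZn.le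
    rwa [div_mul_cancel₀ _ hZn.ne'] at this
  · rw [Complex.arg_of_im_neg]
    · rw [Real.Angle.coe_sub, Real.Angle.coe_two_pi, zero_sub, Real.Angle.coe_neg]
    · by_contra h'
      exact h (div_nonneg (not_lt.mp h') hZn.le)

theorem hasFDerivAt_angleChange {n : ℕ} {p : Config n} {i j k : Fin n} (hi : p i ≠ p j)
    (hk : p k ≠ p j) : ∃ D : Config n →L[ℝ] ℝ, HasFDerivAt (angleChange p i j k) D p ∧
      ∀ v : Config n, D v = inner ℝ (bearing p j i) (perp (v i - v j)) / ‖p i - p j‖ -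
        inner ℝ (bearing p j k) (perp (v k - v j)) / ‖p k - p j‖ := by
  have hu := toC_ne_zero (sub_ne_zero.mpr hi)
  have hw := toC_ne_zero (sub_ne_zero.mpr hk)
  have hu' : 0 < ‖p i - p j‖ := norm_pos_iff.mpr (sub_ne_zero.mpr hi)
  have hw' : 0 < ‖p k - p j‖ := norm_pos_iff.mpr (sub_ne_zero.mpr hk)
  let Li : Config n →L[ℝ] ℂ := toC.comp
    (ContinuousLinearMap.proj (R := ℝ) (φ := fun _ : Fin n => Plane) i -
      ContinuousLinearMap.proj (R := ℝ) (φ := fun _ : Fin n => Plane) j)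
  let Lk : Config n →L[ℝ] ℂ := toC.comp
    (ContinuousLinearMap.proj (R := ℝ) (φ := fun _ : Fin n => Plane) k -
      ContinuousLinearMap.proj (R := ℝ) (φ := fun _ : Fin n => Plane) j)
  let cL : Config n →L[ℝ] ℂ := (Complex.conjCLE : ℂ →L[ℝ] ℂ).comp Li
  let c : ℂ := (starRingEnd ℂ) (Lk p * cL p)
  have hLi : ∀ q, Li q = toC (q i - q j) := fun _ => rfl
  have hLk : ∀ q, Lk q = toC (q k - q j) := fun _ => rfl
  have hcL : ∀ q, cL q = (starRingEnd ℂ) (toC (q i - q j)) := fun _ => rfl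
  have hcp : cL p ≠ 0 := by rw [hcL]; exact (map_ne_zero _).mpr hu
  have hkp : Lk p ≠ 0 := by rw [hLk]; exact hw
  have hc : c ≠ 0 := (map_ne_zero _).mpr (mul_ne_zero hkp hcp)
  have hslit : Lk p * cL p * c ∈ Complex.slitPlane := by
    left
    have : 0 < Complex.normSq (Lk p * cL p) := Complex.normSq_pos.mpr (mul_ne_zero hkp hcp)
    simpa only [c, Complex.mul_conj, Complex.ofReal_re] using this
  have hev : (fun q => (Complex.log (Lk q * cL q * c)).im) =ᶠ[nhds p] angleChange p i j k := by
    have h1 : ∀ᶠ q in nhds p, cL q ≠ 0 := cL.continuous.continuousAt.eventually_ne hcp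
    have h2 : ∀ᶠ q in nhds p, Lk q ≠ 0 := Lk.continuous.continuousAt.eventually_ne hkp
    filter_upwards [h1, h2] with q hq1 hq2
    have hqi : q i ≠ q j := by
      intro h
      apply hq1
      rw [hcL, h, sub_self, map_zero, map_zero]
    have hqk : q k ≠ q j := by
      intro h
      apply hq2
      rw [hLk, h, sub_self, map_zero]
    rw [angleChange, Real.Angle.coe_sub, signedAngle_coe hqi hqk, signedAngle_coe hi hk,
      sub_eq_add_neg, ← Complex.arg_conj_coe_angle, Complex.log_im]
    rw [← hcL, ← hLk, ← hcL, ← hLk]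
    rw [← Complex.arg_mul_coe_angle (mul_ne_zero hq2 hq1) hc, Complex.arg_coe_angle_toReal_eq_arg]
  have hmul := ((Lk.hasFDerivAt (x := p)).mul (cL.hasFDerivAt (x := p))).mul_const c
  have hlog := (Complex.imCLM.hasFDerivAt).comp p
    ((Complex.hasStrictDerivAt_log hslit).hasDerivAt.complexToReal_fderiv.comp p hmul)
  refine ⟨_, hlog.congr_of_eventuallyEq hev.symm, fun v => ?_⟩
  have key : (Lk p * cL p * c)⁻¹ * (c * (Lk p * cL v + cL p * Lk v)) =
      Lk v / Lk p + cL v / cL p := by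
    field_simp
    ring
  trans ((Lk p * cL p * c)⁻¹ * (c * (Lk p * cL v + cL p * Lk v))).im
  · rfl
  have hsq : ∀ x : Plane, ‖x‖ * ‖x‖ = x 0 * x 0 + x 1 * x 1 := fun x => by
    rw [← norm_toC, toC_apply, Complex.norm_mul_self_eq_normSq, Complex.normSq_mk]
  have e1 : ∀ x y : Plane, (toC y / toC x).im = -(inner ℝ x (perp y) / (‖x‖ * ‖x‖)) := by
    intro x y
    rw [Complex.div_im, toC_apply, toC_apply, Complex.normSq_mk, hsq, inner_eq]
    simp only [perp, PiLp.toLp_apply, Matrix.cons_val_zero, Matrix.cons_val_one]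
    ring
  rw [key, hLk, hLk, hcL, hcL, ← map_div₀ (starRingEnd ℂ), Complex.add_im, Complex.conj_im, e1, e1]
  simp only [bearing, real_inner_smul_left]
  field_simp
  ring

theorem rigidityMatrix_apply {n : ℕ} {G : SimpleGraph (Fin n)} {p : Config n}
    (hp : Function.Injective p) (v : Config n) (τ : angleIndexSet G) :
    rigidityMatrix G p v τ =
      inner ℝ (bearing p τ.1.2.1 τ.1.1) (perp (v τ.1.1 - v τ.1.2.1)) / ‖p τ.1.1 - p τ.1.2.1‖ -
      inner ℝ (bearing p τ.1.2.1 τ.1.2.2) (perp (v τ.1.2.2 - v τ.1.2.1)) /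
        ‖p τ.1.2.2 - p τ.1.2.1‖ := by
  obtain ⟨h1, h2, -⟩ := τ.2
  obtain ⟨D, hD, hv⟩ := hasFDerivAt_angleChange (p := p) (hp.ne h1.ne') (hp.ne h2.ne')
  rw [← hv, ← hD.fderiv]
  rfl

end SignedAngle

end

/-! An infinitesimal angle motion makes any two edges sharing a vertex turn at the same rate, so on
a connected graph all edges turn at one common rate. Subtracting a rotation leaves a velocity that
turns no edge, a parallel redrawing. ISAR thus amounts to bearing rigidity: the forms `bearingForm p
e`, one per edge, should have rank `2n - 3`.

Necessity: a maximal independent set of these forms gives a Laman graph. Its sparsity holds because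
scaling and translating a vertex set `S`, with the other points free, satisfies every constraint
inside `S` (`card_add_three_le_of_linearIndependent`).

Sufficiency: edge normals are chosen before the points (`IsLaman.exists_parallel_rigid`). A Laman
graph with one extra edge, possibly a doubled one, satisfies Rado's condition for the planes of
forms `u ↦ ⟪d, u i - u j⟫`; so for suitable normals the forms of the edges and of any one extra pair
are independent. The common kernel of the edge forms then has dimension 3: the translations and one
further configuration `p`. Independence of the extra form prevents `p i = p j`. -/

noncomputable section

namespace SignedAngle

open Module Submodule

/-! ### Rado's theorem for subspaces. -/

section Transversal

variable {K V ι : Type*} [Field K] [AddCommGroup V] [Module K V] [FiniteDimensional K V]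

/-- **Rado's theorem** for a finite family of subspaces, relative to a subspace `W`: if the
members indexed by each `F ⊆ s` raise the dimension of `W` by at least `#F`, then one can choose a
vector in each member such that these vectors are linearly independent modulo `W`. -/
theorem exists_transversal_mod [DecidableEq ι] (A : ι → Submodule K V) (s : Finset ι)
    (W : Submodule K V)
    (h : ∀ F ⊆ s, finrank K W + F.card ≤ finrank K ↥(W ⊔ F.sup A)) :
    ∃ x : ι → V, (∀ e ∈ s, x e ∈ A e) ∧
      finrank K ↥(W ⊔ s.sup fun e => span K {x e}) = finrank K W + s.card := by
  induction s using Finset.strongInduction generalizing W with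
  | H s ih =>
  rcases s.eq_empty_or_nonempty with rfl | ⟨e, he⟩
  · exact ⟨fun _ => 0, by simp, by rw [Finset.sup_empty, sup_bot_eq, Finset.card_empty, add_zero]⟩
  -- A tight proper subfamily `F` is solved first. Its vectors then span `W ⊔ F.sup A`, and the rest
  -- is solved modulo that space.
  by_cases ht : ∃ F ⊂ s, F.Nonempty ∧ finrank K ↥(W ⊔ F.sup A) = finrank K W + F.card
  · obtain ⟨F, hFs, hF, hFt⟩ := ht
    obtain ⟨x, hx, hxW⟩ := ih F hFs W fun F' hF' => h F' (hF'.trans hFs.subset)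
    have hle : (F.sup fun e => span K {x e}) ≤ F.sup A := by
      refine Finset.sup_mono_fun fun e he => ?_
      rw [span_singleton_le_iff_mem]
      exact hx e he
    have hW' : (W ⊔ F.sup fun e => span K {x e}) = W ⊔ F.sup A :=
      eq_of_le_of_finrank_eq (sup_le_sup_left hle W) (hxW.trans hFt.symm)
    have hss : s \ F ⊂ s := by
      refine ⟨Finset.sdiff_subset, fun hh => ?_⟩
      obtain ⟨a, ha⟩ := hF
      exact (Finset.mem_sdiff.mp (hh (hFs.subset ha))).2 ha
    obtain ⟨y, hy, hyW⟩ := ih (s \ F) hss (W ⊔ F.sup A) fun F' hF' => by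
      have hd : Disjoint F F' :=
        (Finset.disjoint_sdiff (s := F) (t := s)).mono_right hF'
      have := h (F ∪ F') (Finset.union_subset hFs.subset (hF'.trans Finset.sdiff_subset))
      rw [Finset.card_union_of_disjoint hd, Finset.sup_union, ← sup_assoc] at this
      omega
    refine ⟨fun e => if e ∈ F then x e else y e, fun e he => ?_, ?_⟩
    · by_cases heF : e ∈ F
      · simpa [heF] using hx e heF
      · simpa [heF] using hy e (Finset.mem_sdiff.mpr ⟨he, heF⟩)
    · have h1 : (F.sup fun e => span K {if e ∈ F then x e else y e}) =
          F.sup fun e => span K {x e} :=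
        Finset.sup_congr rfl fun e he => by simp [he]
      have h2 : ((s \ F).sup fun e => span K {if e ∈ F then x e else y e}) =
          (s \ F).sup fun e => span K {y e} :=
        Finset.sup_congr rfl fun e he => by simp [(Finset.mem_sdiff.mp he).2]
      rw [← Finset.union_sdiff_of_subset hFs.subset, Finset.sup_union,
        Finset.union_sdiff_of_subset hFs.subset, h1, h2, ← sup_assoc, hW', hyW, hFt,
        ← Finset.card_sdiff_add_card_eq_card hFs.subset]
      omega
  -- Without tight proper subfamilies every such inequality is strict, so any vector of `A e`
  -- outside `W` may be chosen: enlarging `W` by it costs one dimension, which the slack covers.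
  · push Not at ht
    have h1 := h {e} (Finset.singleton_subset_iff.mpr he)
    have hnle : ¬ A e ≤ W := fun hle => by
      rw [Finset.sup_singleton, sup_eq_left.mpr hle, Finset.card_singleton] at h1
      omega
    obtain ⟨x, hxA, hxW⟩ := SetLike.not_le_iff_exists.mp hnle
    have hW' : finrank K ↥(W ⊔ span K {x}) = finrank K W + 1 := by
      have hx0 : x ≠ 0 := fun h0 => hxW (h0 ▸ W.zero_mem)
      have hdisj : W ⊓ span K {x} = ⊥ := by
        rw [← disjoint_iff, disjoint_comm]
        exact (disjoint_span_singleton' hx0).mpr hxW |>.symm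
      have := finrank_sup_add_finrank_inf_eq W (span K {x})
      rwa [hdisj, finrank_bot, finrank_span_singleton hx0, add_zero] at this
    obtain ⟨y, hy, hyW⟩ := ih (s.erase e) (Finset.erase_ssubset he) (W ⊔ span K {x})
      fun F hF => by
        rcases F.eq_empty_or_nonempty with rfl | hne
        · rw [Finset.sup_empty, sup_bot_eq, Finset.card_empty, add_zero]
        · have hFs : F ⊂ s := hF.trans_ssubset (Finset.erase_ssubset he)
          have h2 := h F hFs.subset
          have h3 := ht F hFs hne
          have h4 : finrank K ↥(W ⊔ F.sup A) ≤ finrank K ↥(W ⊔ span K {x} ⊔ F.sup A) :=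
            finrank_mono (sup_le_sup_right le_sup_left _)
          omega
    refine ⟨fun a => if a = e then x else y a, fun a ha => ?_, ?_⟩
    · by_cases hae : a = e
      · simpa [hae] using hxA
      · simpa [hae] using hy a (Finset.mem_erase.mpr ⟨hae, ha⟩)
    · have h2 : ((s.erase e).sup fun a => span K {if a = e then x else y a}) =
          (s.erase e).sup fun a => span K {y a} :=
        Finset.sup_congr rfl fun a ha => by simp [(Finset.mem_erase.mp ha).1]
      have h3 : (fun a => if a = e then x else y a) e = x := if_pos rfl
      rw [← Finset.insert_erase he, Finset.sup_insert, h2, h3, ← sup_assoc, hyW, hW',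
        Finset.card_insert_of_notMem (Finset.notMem_erase e s)]
      omega

/-- **Rado's theorem** for a finite family of subspaces. -/
theorem exists_linearIndependent_transversal [Fintype ι] (A : ι → Submodule K V)
    (h : ∀ F : Finset ι, F.card ≤ finrank K ↥(F.sup A)) :
    ∃ x : ι → V, (∀ e, x e ∈ A e) ∧ LinearIndependent K x := by
  classical
  obtain ⟨x, hx, hx'⟩ := exists_transversal_mod A Finset.univ ⊥ fun F _ => by
    rw [bot_sup_eq, finrank_bot, zero_add]
    exact h F
  refine ⟨x, fun e => hx e (Finset.mem_univ e), ?_⟩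
  rw [linearIndependent_iff_card_eq_finrank_span, Set.finrank, span_range_eq_iSup]
  rw [Finset.sup_univ_eq_iSup, bot_sup_eq, finrank_bot, zero_add] at hx'
  exact hx'.symm

end Transversal

/-! ### Generic linear independence along lines. -/

section Generic

variable {K V ι X : Type*} [Field K] [AddCommGroup V] [Module K V]

/-- Along a line through a linearly independent family, all but finitely many families are
linearly independent. -/
theorem finite_not_linearIndependent_add_smul [Finite ι] {x : ι → V}
    (hx : LinearIndependent K x) (y : ι → V) :
    {t : K | ¬ LinearIndependent K (x + t • y)}.Finite := by
  classical
  have := Fintype.ofFinite ι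
  obtain ⟨g, hg⟩ := (Fintype.linearCombination K x).exists_leftInverse_of_injective
    (LinearMap.ker_eq_bot.mpr (hx.fintypeLinearCombination_injective))
  have hgx : ∀ i, g (x i) = Pi.single i 1 := fun i => by
    have := LinearMap.congr_fun hg (Pi.single i 1)
    simpa using this
  -- `g` sends the family `x + t • y` to the rows of `1 + t • M`. The determinant is a polynomial in
  -- `t` with constant term 1, so it vanishes for only finitely many `t`.
  let M : Matrix ι ι K := Matrix.of fun i => g (y i)
  have hP : (-M).charpolyRev ≠ 0 := fun h0 => by
    have := Matrix.eval_charpolyRev (M := -M)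
    rw [h0] at this
    simp at this
  refine (Polynomial.finite_setOfPred_isRoot hP).subset fun t ht => ?_
  by_contra hroot
  apply ht
  have hdet : (1 + t • M).det ≠ 0 := by
    intro h0
    apply hroot
    change Polynomial.eval t (Matrix.charpolyRev (-M)) = 0
    rw [Matrix.charpolyRev, ← Polynomial.coe_evalRingHom, RingHom.map_det, ← h0]
    congr 1
    ext i j
    rcases eq_or_ne i j with rfl | hij <;> simp [*, mul_comm t]
  refine LinearIndependent.of_comp g ?_
  have : (g ∘ (x + t • y)) = (1 + t • M).row := by
    funext i j
    simp [hgx, M, Matrix.one_apply, Pi.single_apply, eq_comm]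
  rw [this]
  exact Matrix.linearIndependent_rows_of_det_ne_zero hdet

/-- Finitely many linear families of vectors, each of which is linearly independent for some
parameter, are linearly independent for a common parameter. -/
theorem exists_forall_linearIndependent [Infinite K] [AddCommGroup X] [Module K X] {κ : Type*}
    (s : Finset κ) [Finite ι] (f : κ → ι → X →ₗ[K] V)
    (h : ∀ k ∈ s, ∃ x, LinearIndependent K fun i => f k i x) :
    ∃ x, ∀ k ∈ s, LinearIndependent K fun i => f k i x := by
  classical
  induction s using Finset.induction_on with
  | empty => exact ⟨0, by simp⟩
  | insert k s hk ih =>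
    obtain ⟨x, hx⟩ := ih fun l hl => h l (Finset.mem_insert_of_mem hl)
    obtain ⟨y, hy⟩ := h k (Finset.mem_insert_self k s)
    have h1 : (⋃ l ∈ s, {t : K | ¬ LinearIndependent K
        ((fun i => f l i x) + t • fun i => f l i y)}).Finite :=
      s.finite_toSet.biUnion fun l hl => finite_not_linearIndependent_add_smul (hx l hl) _
    -- On the same line `x + t • y`, the new family is seen from `y`: up to the factor `t` it is the
    -- family at `y + t⁻¹ • x`, so the bad parameters are inverses.
    have h2 := (finite_not_linearIndependent_add_smul hy fun i => f k i x).image (·⁻¹)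
    obtain ⟨t, ht⟩ := ((h1.union h2).union (Set.finite_singleton 0)).exists_notMem
    simp only [Set.mem_union, Set.mem_iUnion, Set.mem_ofPred_eq, Set.mem_image,
      Set.mem_singleton_iff, not_or, not_exists, not_and, exists_prop, not_not] at ht
    obtain ⟨⟨h1, h2⟩, h0⟩ := ht
    refine ⟨x + t • y, fun l hl => ?_⟩
    rcases Finset.mem_insert.mp hl with rfl | hl
    · have h3 : LinearIndependent K ((fun i => f l i y) + t⁻¹ • fun i => f l i x) := by
        by_contra h3
        exact h2 _ h3 (inv_inv t)
      have := h3.units_smul fun _ => Units.mk0 t h0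
      convert this using 1
      funext i
      simp [Units.smul_def, smul_smul, h0, add_comm]
    · convert h1 l hl using 1
      funext i
      simp

end Generic

/-! ### Edge counts in Laman graphs by connected components. -/

section Components

variable {V : Type*} [Fintype V]

/-- The number of edges of a subgraph of a Laman-sparse graph, against the components of a
graph `K` containing it. -/
theorem ncard_edgeSet_add_sum_components_le {L H K : SimpleGraph V}
    (hL : ∀ S : L.Subgraph, 2 ≤ S.verts.ncard → S.edgeSet.ncard + 3 ≤ 2 * S.verts.ncard)
    (hHL : H ≤ L) (hHK : H ≤ K) [Fintype K.ConnectedComponent] :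
    H.edgeSet.ncard + ∑ C : K.ConnectedComponent, (if 2 ≤ C.supp.ncard then 3 else 2) ≤
      2 * Fintype.card V := by
  classical
  let comp : Sym2 V → K.ConnectedComponent := fun e => K.connectedComponentMk e.out.1
  have hV : Fintype.card V = ∑ C : K.ConnectedComponent, C.supp.ncard := by
    rw [← Finset.card_univ, Finset.card_eq_sum_card_fiberwise
      (f := K.connectedComponentMk) (t := Finset.univ) (fun _ _ => Finset.mem_univ _)]
    refine Finset.sum_congr rfl fun C _ => ?_
    rw [← Set.ncard_coe_finset]
    congr 1
    ext v
    simp [SimpleGraph.ConnectedComponent.mem_supp_iff]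
  have hE : H.edgeSet.ncard =
      ∑ C : K.ConnectedComponent, {e | e ∈ H.edgeSet ∧ comp e = C}.ncard := by
    rw [Set.ncard_eq_toFinset_card', Finset.card_eq_sum_card_fiberwise
      (f := comp) (t := Finset.univ) (fun _ _ => Finset.mem_univ _)]
    refine Finset.sum_congr rfl fun C _ => ?_
    rw [← Set.ncard_coe_finset]
    congr 1
    ext e
    simp
  rw [hE, hV, ← Finset.sum_add_distrib, Finset.mul_sum]
  refine Finset.sum_le_sum fun C _ => ?_
  -- The part of `H` inside `C`. Sparsity of `L` gives the summand 3; a one-vertex component has no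
  -- edges, and `0 + 2 = 2 * 1` gives the summand 2.
  let S : L.Subgraph :=
    { verts := C.supp
      Adj := fun a b => H.Adj a b ∧ a ∈ C.supp ∧ b ∈ C.supp
      adj_sub := fun h => hHL h.1
      edge_vert := fun h => h.2.1
      symm := ⟨fun _ _ h => ⟨h.1.symm, h.2.2, h.2.1⟩⟩ }
  have hS : {e | e ∈ H.edgeSet ∧ comp e = C} ⊆ S.edgeSet := by
    rintro e ⟨he, hC⟩
    have heq : s(e.out.1, e.out.2) = e := Quot.out_eq e
    rw [← heq] at he ⊢
    rw [SimpleGraph.mem_edgeSet] at he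
    rw [SimpleGraph.Subgraph.mem_edgeSet]
    refine ⟨he, hC, ?_⟩
    rw [SimpleGraph.ConnectedComponent.mem_supp_iff, ← hC]
    exact SimpleGraph.ConnectedComponent.connectedComponentMk_eq_of_adj (hHK he).symm
  have hle := Set.ncard_le_ncard hS (Set.toFinite _)
  split_ifs with h2
  · have : S.verts = C.supp := rfl
    have := hL S h2
    grind
  · have h1 : 1 ≤ C.supp.ncard := by
      rw [Nat.one_le_iff_ne_zero, Ne, Set.ncard_eq_zero (Set.toFinite _)]
      exact C.nonempty_supp.ne_empty
    have h0 : S.edgeSet = ∅ := by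
      rw [Set.eq_empty_iff_forall_notMem]
      intro e
      induction e using Sym2.ind with
      | _ a b =>
        rw [SimpleGraph.Subgraph.mem_edgeSet]
        rintro ⟨hab, ha, hb⟩
        apply h2
        rw [← Set.ncard_pair hab.ne]
        exact Set.ncard_le_ncard (by rintro x (rfl | rfl) <;> assumption) (Set.toFinite _)
    rw [h0, Set.ncard_empty] at hle
    omega

theorem IsLaman.ncard_edgeSet_add_components_le {L H : SimpleGraph V} (hL : IsLaman L)
    (hHL : H ≤ L) [Fintype H.ConnectedComponent] :
    H.edgeSet.ncard + 2 * Fintype.card H.ConnectedComponent ≤ 2 * Fintype.card V := by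
  have h := ncard_edgeSet_add_sum_components_le hL.2.2 hHL le_rfl (K := H)
  have h2 : 2 * Fintype.card H.ConnectedComponent ≤
      ∑ C : H.ConnectedComponent, (if 2 ≤ C.supp.ncard then 3 else 2) := by
    rw [mul_comm, ← smul_eq_mul, ← Finset.card_univ, ← Finset.sum_const]
    exact Finset.sum_le_sum fun C _ => by split_ifs <;> norm_num
  omega

/-- With `c` components the count reads `(2m - 3) + 2c ≤ 2m`, which forces `c ≤ 1`. -/
theorem IsLaman.connected {L : SimpleGraph V} (hL : IsLaman L) : L.Connected := by
  classical
  have : Nonempty V := Fintype.card_pos_iff.mp (by have := hL.1; omega)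
  have h := hL.ncard_edgeSet_add_components_le le_rfl
  have h3 := hL.2.1
  have h4 : Fintype.card L.ConnectedComponent ≤ 1 := by omega
  rw [Fintype.card_le_one_iff_subsingleton] at h4
  exact (SimpleGraph.connected_iff L).mpr
    ⟨fun u v => SimpleGraph.ConnectedComponent.exact (Subsingleton.elim _ _), this⟩

/-- Adding one edge (possibly parallel to an old one) to a subgraph of a Laman graph. -/
theorem ncard_edgeSet_add_one_add_components_le {L H K : SimpleGraph V} (hL : IsLaman L)
    (hHL : H ≤ L) (hHK : H ≤ K) {i j : V} (hK : K.Adj i j) [Fintype K.ConnectedComponent] :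
    H.edgeSet.ncard + 1 + 2 * Fintype.card K.ConnectedComponent ≤ 2 * Fintype.card V := by
  have h := ncard_edgeSet_add_sum_components_le hL.2.2 hHL hHK
  -- The component of `i` and `j` has at least two vertices, so it counts 3 rather than 2; this
  -- surplus pays for the added edge.
  have h2 : 2 * Fintype.card K.ConnectedComponent <
      ∑ C : K.ConnectedComponent, (if 2 ≤ C.supp.ncard then 3 else 2) := by
    rw [mul_comm, ← smul_eq_mul, ← Finset.card_univ, ← Finset.sum_const]
    refine Finset.sum_lt_sum (fun C _ => by split_ifs <;> norm_num)
      ⟨K.connectedComponentMk i, Finset.mem_univ _, ?_⟩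
    rw [if_pos]
    · norm_num
    · rw [← Set.ncard_pair hK.ne]
      refine Set.ncard_le_ncard ?_ (Set.toFinite _)
      rintro x (rfl | rfl)
      · rfl
      · exact SimpleGraph.ConnectedComponent.connectedComponentMk_eq_of_adj hK.symm
  omega

end Components

/-! ### Linear forms of edges with freely chosen normals. -/

variable {n : ℕ}

/-- The linear form `u ↦ ⟪d, u i - u j⟫` on velocities, depending linearly on `d`. -/
def edgeForm (i j : Fin n) : Plane →ₗ[ℝ] Dual ℝ (Config n) :=
  LinearMap.lcomp ℝ ℝ
    (LinearMap.proj (R := ℝ) (φ := fun _ : Fin n => Plane) i - LinearMap.proj j) ∘ₗ innerₗ Plane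

@[simp]
theorem edgeForm_apply (i j : Fin n) (d : Plane) (u : Config n) :
    edgeForm i j d u = inner ℝ d (u i - u j) := rfl

theorem finrank_config : finrank ℝ (Config n) = 2 * n := by
  simp [Config, finrank_pi_fintype, mul_comm]

/-- The subspace of velocities that are constant on the components of `K`. -/
def constOn (K : SimpleGraph (Fin n)) : Submodule ℝ (Config n) where
  carrier := {u | ∀ i j, K.Adj i j → u i = u j}
  add_mem' := fun ha hb i j h => by simp [ha i j h, hb i j h]
  zero_mem' := fun _ _ _ => rfl
  smul_mem' := fun c _ ha i j h => by simp [ha i j h]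

/-- Such a velocity is determined by its values at one representative per component. -/
theorem finrank_constOn_le (K : SimpleGraph (Fin n)) [Fintype K.ConnectedComponent] :
    finrank ℝ (constOn K) ≤ 2 * Fintype.card K.ConnectedComponent := by
  let f : constOn K →ₗ[ℝ] (K.ConnectedComponent → Plane) :=
    (LinearMap.funLeft ℝ Plane fun C => C.out) ∘ₗ (constOn K).subtype
  have hf : Function.Injective f := by
    rw [← LinearMap.ker_eq_bot, LinearMap.ker_eq_bot']
    intro u hu
    ext1
    funext i
    have h1 : u.1 (K.connectedComponentMk i).out = 0 := congr_fun hu (K.connectedComponentMk i)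
    have h2 : K.Reachable (K.connectedComponentMk i).out i :=
      SimpleGraph.ConnectedComponent.exact (Quot.out_eq (K.connectedComponentMk i))
    have h3 : ∀ a b, K.Reachable a b → u.1 a = u.1 b := by
      rintro a b ⟨w⟩
      induction w with
      | nil => rfl
      | cons h _ ih => exact (u.2 _ _ h).trans ih
    exact (h3 _ _ h2).symm.trans h1
  have := LinearMap.finrank_le_finrank_of_injective hf
  simpa [finrank_pi_fintype, mul_comm] using this

/-- The forms attached to a set of pairs of vertices span a space of dimension at least twice
the rank of a graph containing these pairs as edges. -/
theorem two_mul_le_finrank_add {ι : Type*} (F : Finset ι) (s t : ι → Fin n)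
    (K : SimpleGraph (Fin n)) [Fintype K.ConnectedComponent]
    (hK : ∀ i j, K.Adj i j → ∃ e ∈ F, s(s e, t e) = s(i, j)) :
    2 * n ≤ finrank ℝ ↥(F.sup fun e => LinearMap.range (edgeForm (s e) (t e))) +
      2 * Fintype.card K.ConnectedComponent := by
  set A := F.sup fun e => LinearMap.range (edgeForm (s e) (t e)) with hA
  have h1 := Subspace.finrank_add_finrank_dualCoannihilator_eq A
  rw [finrank_config] at h1
  -- The normal `d` is arbitrary in each range, so a velocity killed by all of `A` agrees at both
  -- ends of every pair.
  have h2 : A.dualCoannihilator ≤ constOn K := by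
    intro u hu i j hij
    obtain ⟨e, he, hij'⟩ := hK i j hij
    have h3 : ∀ d, inner ℝ d (u (s e) - u (t e)) = 0 := fun d => by
      rw [mem_dualCoannihilator] at hu
      refine hu (edgeForm (s e) (t e) d) ?_
      exact (Finset.le_sup (f := fun e => LinearMap.range (edgeForm (s e) (t e))) he) ⟨d, rfl⟩
    have h4 : u (s e) = u (t e) := sub_eq_zero.mp (inner_self_eq_zero.mp (h3 _))
    rcases Sym2.eq_iff.mp hij' with ⟨h, h'⟩ | ⟨h, h'⟩
    · rw [← h, ← h', h4]
    · rw [← h, ← h', h4]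
  have h3 := finrank_mono h2
  have h4 := finrank_constOn_le K
  omega

theorem inner_perp (x y : Plane) : inner ℝ x (perp y) = x 1 * y 0 - x 0 * y 1 := by
  rw [inner_eq]
  simp only [perp, PiLp.toLp_apply, Matrix.cons_val_zero, Matrix.cons_val_one]
  ring

theorem inner_perp_left (x y : Plane) : inner ℝ (perp x) y = -inner ℝ x (perp y) := by
  rw [inner_eq, inner_eq]
  simp only [perp, PiLp.toLp_apply, Matrix.cons_val_zero, Matrix.cons_val_one]
  ring

theorem inner_eq_zero_of_parallel {d x y : Plane} (hx : x ≠ 0) (hd : inner ℝ d x = 0)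
    (hxy : inner ℝ x (perp y) = 0) : inner ℝ d y = 0 := by
  rw [inner_perp] at hxy
  rw [inner_eq] at hd ⊢
  have h0 : x 0 * (d 0 * y 0 + d 1 * y 1) = 0 := by linear_combination y 0 * hd - d 1 * hxy
  have h1 : x 1 * (d 0 * y 0 + d 1 * y 1) = 0 := by linear_combination y 1 * hd + d 0 * hxy
  by_contra hne
  apply hx
  ext i
  fin_cases i
  · exact (mul_eq_zero.mp h0).resolve_right hne
  · exact (mul_eq_zero.mp h1).resolve_right hne

/-- The forms of the edges of `L` and of one extra pair `k`, as functions of the directions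
assigned to the edges and to all pairs. -/
def directionForm (L : SimpleGraph (Fin n)) (k : Fin n × Fin n) (o : Option L.edgeSet) :
    ((L.edgeSet ⊕ Fin n × Fin n) → Plane) →ₗ[ℝ] Dual ℝ (Config n) :=
  match o with
  | none => edgeForm k.1 k.2 ∘ₗ LinearMap.proj (Sum.inr k)
  | some e => edgeForm e.1.out.1 e.1.out.2 ∘ₗ LinearMap.proj (Sum.inl e)

/-- Rado's condition follows by comparing two counts: a subfamily spans dimension at least `2n -
2c`, with `c` the number of components of its graph, and sparsity bounds its size by the same
number. The pair `k` may coincide with an edge of `L`. -/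
theorem IsLaman.exists_linearIndependent_directionForm {L : SimpleGraph (Fin n)} (hL : IsLaman L)
    {k : Fin n × Fin n} (hk : k.1 ≠ k.2) :
    ∃ x, LinearIndependent ℝ fun o => directionForm L k o x := by
  classical
  let s : Option L.edgeSet → Fin n := fun o => o.elim k.1 fun e => e.1.out.1
  let t : Option L.edgeSet → Fin n := fun o => o.elim k.2 fun e => e.1.out.2
  obtain ⟨r, hr, hind⟩ := exists_linearIndependent_transversal
    (fun o => LinearMap.range (edgeForm (s o) (t o))) fun F => by
      let B : Set (Sym2 (Fin n)) := Subtype.val '' (F.eraseNone : Set L.edgeSet)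
      have hBL : B ⊆ L.edgeSet := by
        rintro _ ⟨e, -, rfl⟩
        exact e.2
      let H : SimpleGraph (Fin n) := SimpleGraph.fromEdgeSet B
      have hHL : H ≤ L := by
        intro a b hab
        exact hBL ((SimpleGraph.fromEdgeSet_adj B).mp hab).1
      have hH : H.edgeSet.ncard = F.eraseNone.card := by
        have : H.edgeSet = B := by
          rw [SimpleGraph.edgeSet_fromEdgeSet, sdiff_eq_left, Set.disjoint_left]
          intro e he
          exact L.not_isDiag_of_mem_edgeSet (hBL he)
        rw [this, Set.ncard_image_of_injective _ Subtype.val_injective, Set.ncard_coe_finset]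
      have hHF : ∀ i j, H.Adj i j → ∃ e ∈ F, s(s e, t e) = s(i, j) := by
        intro i j hij
        obtain ⟨e, he, heq⟩ := ((SimpleGraph.fromEdgeSet_adj B).mp hij).1
        exact ⟨some e, Finset.mem_eraseNone.mp he, (Quot.out_eq e.1).trans heq⟩
      by_cases hF : none ∈ F
      · obtain ⟨K, hK⟩ : ∃ K, K = H ⊔ SimpleGraph.edge k.1 k.2 := ⟨_, rfl⟩
        have hKk : K.Adj k.1 k.2 := by simp [hK, SimpleGraph.edge_adj, hk]
        have hHK : H ≤ K := hK ▸ le_sup_left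
        have h1 := ncard_edgeSet_add_one_add_components_le hL hHL hHK hKk
        have h2 := two_mul_le_finrank_add F s t K fun i j hij => by
          rw [hK, SimpleGraph.sup_adj] at hij
          rcases hij with hij | hij
          · exact hHF i j hij
          · refine ⟨none, hF, ?_⟩
            rw [SimpleGraph.edge_adj] at hij
            rcases hij.1 with ⟨h, h'⟩ | ⟨h, h'⟩
            · exact Sym2.eq_iff.mpr (Or.inl ⟨h.symm, h'.symm⟩)
            · exact Sym2.eq_iff.mpr (Or.inr ⟨h'.symm, h.symm⟩)
        rw [Fintype.card_fin] at h1
        have h3 := Finset.card_eraseNone_of_mem hF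
        omega
      · have h1 := hL.ncard_edgeSet_add_components_le hHL
        have h2 := two_mul_le_finrank_add F s t H hHF
        rw [Fintype.card_fin] at h1
        have h3 := Finset.card_eraseNone_of_not_mem hF
        omega
  choose d hd using hr
  refine ⟨Sum.elim (fun e => d (some e)) fun _ => d none, ?_⟩
  have heq : (fun o => directionForm L k o
      (Sum.elim (fun e => d (some e)) fun _ => d none)) = r := by
    funext o
    rw [← hd o]
    cases o <;> rfl
  rw [heq]
  exact hind

/-! ### Realizing Laman graphs from generic normals. -/

/-- The uniform translations. -/
def translation (n : ℕ) : Plane →ₗ[ℝ] Config n := LinearMap.pi fun _ => LinearMap.id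

@[simp]
theorem translation_apply (w : Plane) (i : Fin n) : translation n w i = w := rfl

/-- A Laman graph has a configuration of distinct points all of whose parallel redrawings are
generated by the scaling and the translations. -/
theorem IsLaman.exists_parallel_rigid {L : SimpleGraph (Fin n)} (hL : IsLaman L) :
    ∃ p : Config n, Function.Injective p ∧ ∀ v : Config n,
      (∀ i j, L.Adj i j → inner ℝ (p i - p j) (perp (v i - v j)) = 0) →
        ∃ (a : ℝ) (w : Plane), ∀ i, v i = a • p i + w := by
  classical
  have hn : 3 ≤ n := by simpa using hL.1
  -- The edge normals are shared by all `k`, while each pair has its own slot in `x`; one choice of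
  -- edge normals therefore serves every pair.
  obtain ⟨x, hx⟩ := exists_forall_linearIndependent (K := ℝ)
    (Finset.univ.filter fun k : Fin n × Fin n => k.1 ≠ k.2) (directionForm L)
    fun k hk => hL.exists_linearIndependent_directionForm (Finset.mem_filter.mp hk).2
  let r : L.edgeSet → Dual ℝ (Config n) := fun e =>
    edgeForm e.1.out.1 e.1.out.2 (x (Sum.inl e))
  have hrk : ∀ i j : Fin n, i ≠ j → LinearIndependent ℝ r ∧
      edgeForm i j (x (Sum.inr (i, j))) ∉ span ℝ (Set.range r) := by
    intro i j hij
    have := hx (i, j) (Finset.mem_filter.mpr ⟨Finset.mem_univ _, hij⟩)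
    rw [linearIndependent_option] at this
    exact this
  have hr : LinearIndependent ℝ r :=
    (hrk ⟨0, by omega⟩ ⟨1, by omega⟩ (by simp)).1
  let Q := (span ℝ (Set.range r)).dualCoannihilator
  have hQ : ∀ u : Config n, u ∈ Q ↔
      ∀ e : L.edgeSet, inner ℝ (x (Sum.inl e)) (u e.1.out.1 - u e.1.out.2) = 0 := by
    intro u
    rw [mem_dualCoannihilator]
    refine ⟨fun h e => h (r e) (subset_span ⟨e, rfl⟩), fun h φ hφ => ?_⟩
    induction hφ using span_induction with
    | mem φ hφ =>
      obtain ⟨e, rfl⟩ := hφ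
      exact h e
    | zero => rfl
    | add φ ψ _ _ h1 h2 => simp [h1, h2]
    | smul c φ _ h1 => simp [h1]
  have hQ3 : finrank ℝ Q = 3 := by
    have h1 := Subspace.finrank_add_finrank_dualCoannihilator_eq (span ℝ (Set.range r))
    rw [finrank_config, finrank_span_eq_card hr, ← Nat.card_eq_fintype_card,
      Nat.card_coe_set_eq] at h1
    have h2 := hL.2.1
    rw [Fintype.card_fin] at h2
    change _ + finrank ℝ Q = _ at h1
    omega
  let T := LinearMap.range (translation n)
  have hT2 : finrank ℝ T = 2 := by
    rw [LinearMap.finrank_range_of_inj]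
    · simp
    · intro w w' h
      exact congr_fun h ⟨0, by omega⟩
  have hTQ : T ≤ Q := by
    rintro _ ⟨w, rfl⟩
    rw [hQ]
    simp
  have hlt : T < Q := lt_of_le_of_ne hTQ fun h => by rw [h] at hT2; omega
  obtain ⟨p, hpQ, hpT⟩ := SetLike.exists_of_lt hlt
  have hgen : T ⊔ span ℝ {p} = Q := by
    refine eq_of_le_of_finrank_le (sup_le hTQ ((span_singleton_le_iff_mem p Q).mpr hpQ)) ?_
    have : T < T ⊔ span ℝ {p} := left_lt_sup.mpr fun h => hpT (h (mem_span_singleton_self p))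
    have := finrank_lt_finrank_of_lt this
    omega
  have hgen' : ∀ u ∈ Q, ∃ (a : ℝ) (w : Plane), ∀ i, u i = a • p i + w := by
    intro u hu
    rw [← hgen, mem_sup] at hu
    obtain ⟨_, ⟨w, rfl⟩, _, hz, rfl⟩ := hu
    obtain ⟨a, rfl⟩ := mem_span_singleton.mp hz
    exact ⟨a, w, fun i => by simp [add_comm]⟩
  -- If `p i = p j`, then `u i = u j` for all `u ∈ Q`. The extra form of the pair would vanish on
  -- `Q` and so lie in the span of the edge forms.
  have hp : Function.Injective p := by
    intro i j hij
    by_contra hne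
    apply (hrk i j hne).2
    rw [← Subspace.dualCoannihilator_dualAnnihilator_eq (W := span ℝ (Set.range r)),
      mem_dualAnnihilator]
    intro u hu
    obtain ⟨a, w, h⟩ := hgen' u hu
    simp [h, hij]
  refine ⟨p, hp, fun v hv => hgen' v ((hQ v).mpr fun e => ?_)⟩
  have he : L.Adj e.1.out.1 e.1.out.2 := by
    rw [← SimpleGraph.mem_edgeSet]
    have : s(e.1.out.1, e.1.out.2) = e.1 := Quot.out_eq e.1
    rw [this]
    exact e.2
  exact inner_eq_zero_of_parallel (sub_ne_zero.mpr (hp.ne he.ne)) ((hQ p).mp hpQ e) (hv _ _ he)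

/-! ### Angular velocities and sufficiency. -/

theorem perp_add (x y : Plane) : perp (x + y) = perp x + perp y := by
  ext i
  fin_cases i <;> simp [perp, add_comm]

theorem perp_smul (c : ℝ) (x : Plane) : perp (c • x) = c • perp x := by
  ext i
  fin_cases i <;> simp [perp]

theorem perp_sub (x y : Plane) : perp (x - y) = perp x - perp y := by
  rw [sub_eq_add_neg, ← neg_one_smul ℝ y, perp_add, perp_smul, neg_one_smul, ← sub_eq_add_neg]

theorem perp_perp (x : Plane) : perp (perp x) = -x := by
  ext i
  fin_cases i <;> simp [perp]

/-- The angular velocity of the edge from `j` to `i`, clockwise. -/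
def angularVelocity (p v : Config n) (j i : Fin n) : ℝ :=
  inner ℝ (bearing p j i) (perp (v i - v j)) / ‖p i - p j‖

theorem angularVelocity_eq (p v : Config n) (j i : Fin n) :
    angularVelocity p v j i = inner ℝ (p i - p j) (perp (v i - v j)) / ‖p i - p j‖ ^ 2 := by
  rw [angularVelocity, bearing, real_inner_smul_left, sq, inv_mul_eq_div, div_div]

theorem angularVelocity_comm (p v : Config n) (i j : Fin n) :
    angularVelocity p v j i = angularVelocity p v i j := by
  rw [angularVelocity_eq, angularVelocity_eq, norm_sub_rev]
  congr 1
  rw [← neg_sub (p j), ← neg_sub (v j), ← neg_one_smul ℝ (v j - v i), perp_smul, neg_one_smul,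
    inner_neg_neg]

/-- The derivative of an angle is the difference of the angular velocities of its two sides.
Equality is symmetric, so the restriction `i < k` disappears. -/
theorem isInfinitesimalMotion_iff {G : SimpleGraph (Fin n)} {p : Config n}
    (hp : Function.Injective p) (v : Config n) :
    IsInfinitesimalMotion G p v ↔
      ∀ i j k, G.Adj j i → G.Adj j k → angularVelocity p v j i = angularVelocity p v j k := by
  constructor
  · intro h
    have key : ∀ i j k, G.Adj j i → G.Adj j k → i < k →
        angularVelocity p v j i = angularVelocity p v j k := by
      intro i j k hi hk hik
      have := rigidityMatrix_apply (G := G) hp v ⟨(i, j, k), hi, hk, hik⟩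
      rw [h] at this
      exact (sub_eq_zero.mp this.symm)
    intro i j k hi hk
    rcases lt_trichotomy i k with h1 | rfl | h1
    · exact key i j k hi hk h1
    · rfl
    · exact (key k j i hk hi h1).symm
  · intro h
    funext τ
    rw [rigidityMatrix_apply hp]
    exact sub_eq_zero.mpr (h _ _ _ τ.2.1 τ.2.2.1)

theorem mem_trivialMotions {p v : Config n} :
    v ∈ trivialMotions p ↔ ∃ (a b : ℝ) (w : Plane), ∀ i, v i = a • p i + b • perp (p i) + w := by
  simp only [trivialMotions, mem_sup, mem_span_singleton, mem_span_pair]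
  constructor
  · rintro ⟨_, ⟨_, ⟨a, rfl⟩, _, ⟨b, rfl⟩, rfl⟩, _, ⟨c, d, rfl⟩, rfl⟩
    refine ⟨a, b, c • !₂[1, 0] + d • !₂[0, 1], fun i => ?_⟩
    simp only [Pi.add_apply, Pi.smul_apply]
  · rintro ⟨a, b, w, h⟩
    refine ⟨_, ⟨_, ⟨a, rfl⟩, _, ⟨b, rfl⟩, rfl⟩, _, ⟨w 0, w 1, rfl⟩, ?_⟩
    funext i
    rw [h]
    ext l
    fin_cases l <;> simp

/-- Along a connected graph, all edges turn with the same angular velocity. -/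
theorem exists_angularVelocity_eq {L : SimpleGraph (Fin n)} (hL : L.Connected) {p v : Config n}
    (h : ∀ i j k, L.Adj j i → L.Adj j k → angularVelocity p v j i = angularVelocity p v j k) :
    ∃ c, ∀ i j, L.Adj j i → angularVelocity p v j i = c := by
  by_cases he : ∃ i₀ j₀, L.Adj j₀ i₀
  · obtain ⟨i₀, j₀, h₀⟩ := he
    refine ⟨angularVelocity p v j₀ i₀, fun i j hij => ?_⟩
    obtain ⟨w⟩ := hL.preconnected j j₀
    induction w generalizing i with
    | nil => exact h _ _ _ hij h₀
    | @cons a b c hab _ ih =>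
      rw [h i a b hij hab, ← angularVelocity_comm]
      exact ih h₀ a hab.symm
  · push Not at he
    exact ⟨0, fun i j hij => absurd hij (he i j)⟩

theorem IsLaman.graphISAR {L G : SimpleGraph (Fin n)} (hL : IsLaman L) (hLG : L ≤ G) :
    GraphISAR G := by
  obtain ⟨p, hp, hrigid⟩ := hL.exists_parallel_rigid
  refine ⟨p, hp, fun v hv => ?_⟩
  rw [isInfinitesimalMotion_iff hp] at hv
  obtain ⟨c, hc⟩ := exists_angularVelocity_eq hL.connected (p := p) (v := v)
    fun i j k hi hk => hv i j k (hLG hi) (hLG hk)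
  -- Angular velocity is measured clockwise, so adding `c` times the counter-clockwise rotation
  -- cancels the common rate and leaves a parallel redrawing.
  obtain ⟨a, w, h⟩ := hrigid (fun i => v i + c • perp (p i)) fun i j hij => by
    have h1 := hc i j hij.symm
    have h2 : ‖p i - p j‖ ^ 2 ≠ 0 :=
      pow_ne_zero 2 (norm_ne_zero_iff.mpr (sub_ne_zero.mpr (hp.ne hij.ne)))
    rw [angularVelocity_eq, div_eq_iff h2] at h1
    have h3 : v i + c • perp (p i) - (v j + c • perp (p j)) =
        (v i - v j) + c • perp (p i - p j) := by
      rw [perp_sub, smul_sub]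
      abel
    rw [h3, perp_add, perp_smul, perp_perp, inner_add_right, h1, real_inner_smul_right,
      inner_neg_right, real_inner_self_eq_norm_sq]
    ring
  rw [mem_trivialMotions]
  refine ⟨a, -c, w, fun i => ?_⟩
  rw [eq_sub_of_add_eq (h i), neg_smul]
  abel

/-! ### Rank of the bearing constraints and necessity. -/

/-- The form whose kernel consists of the velocities that do not turn the edge `e`. -/
def bearingForm (p : Config n) (e : Sym2 (Fin n)) : Dual ℝ (Config n) :=
  edgeForm e.out.1 e.out.2 (perp (p e.out.1 - p e.out.2))

theorem bearingForm_apply (p : Config n) (e : Sym2 (Fin n)) (u : Config n) :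
    bearingForm p e u =
      -inner ℝ (p e.out.1 - p e.out.2) (perp (u e.out.1 - u e.out.2)) := by
  rw [bearingForm, edgeForm_apply, inner_perp_left]

/-- The velocities that scale and translate the points of `S`. -/
def similarityOn (p : Config n) (S : Set (Fin n)) [DecidablePred (· ∈ S)] :
    ((↥Sᶜ → Plane) × ℝ × Plane) →ₗ[ℝ] Config n where
  toFun x i := if h : i ∈ S then x.2.1 • p i + x.2.2 else x.1 ⟨i, h⟩
  map_add' x y := by
    funext i
    by_cases h : i ∈ S
    · simp only [h, dite_true, Prod.snd_add, Prod.fst_add, Pi.add_apply, add_smul]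
      abel
    · simp [h]
  map_smul' c x := by
    funext i
    by_cases h : i ∈ S
    · simp [h, mul_smul]
    · simp [h]

/-- Two distinct points of `S` determine the scaling factor and the translation, so the
parametrization is injective, with `2(n - #S) + 3` parameters. -/
theorem finrank_range_similarityOn {p : Config n} (hp : Function.Injective p) {S : Set (Fin n)}
    [DecidablePred (· ∈ S)] (hS : 2 ≤ S.ncard) :
    finrank ℝ (LinearMap.range (similarityOn p S)) + 2 * S.ncard = 2 * n + 3 := by
  obtain ⟨i, hi, j, hj, hij⟩ := (Set.one_lt_ncard (Set.toFinite S)).mp hS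
  rw [LinearMap.finrank_range_of_inj]
  · have h1 := Set.ncard_add_ncard_compl S
    rw [Nat.card_eq_fintype_card, Fintype.card_fin] at h1
    have h2 : Fintype.card ↥Sᶜ = Sᶜ.ncard := by
      rw [← Nat.card_eq_fintype_card, Nat.card_coe_set_eq]
    have h3 : finrank ℝ ((↥Sᶜ → Plane) × ℝ × Plane) = 2 * Fintype.card ↥Sᶜ + 3 := by
      rw [finrank_prod, finrank_prod, finrank_pi_fintype]
      simp [mul_comm]
    rw [h3, h2]
    omega
  · rw [← LinearMap.ker_eq_bot, LinearMap.ker_eq_bot']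
    rintro ⟨w, a, c⟩ h
    have hin : ∀ l ∈ S, a • p l + c = 0 := fun l hl => by
      simpa [similarityOn, hl] using congr_fun h l
    have ha : a = 0 := by
      have : a • (p i - p j) = 0 := by
        rw [smul_sub, sub_eq_zero]
        exact add_right_cancel ((hin i hi).trans (hin j hj).symm)
      exact (smul_eq_zero.mp this).resolve_right (sub_ne_zero.mpr (hp.ne hij))
    have hc : c = 0 := by simpa [ha] using hin i hi
    have hw : w = 0 := by
      funext ⟨l, hl⟩
      have := congr_fun h l
      simpa [similarityOn, show l ∉ S from hl] using this
    rw [ha, hc, hw]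
    rfl

/-- Independent bearing constraints among the points of `S` number at most `2 #S - 3`. -/
theorem card_add_three_le_of_linearIndependent {p : Config n} (hp : Function.Injective p)
    {S : Set (Fin n)} (hS : 2 ≤ S.ncard) {B : Set (Sym2 (Fin n))}
    (hB : ∀ e ∈ B, e.out.1 ∈ S ∧ e.out.2 ∈ S)
    (hind : LinearIndependent ℝ fun e : B => bearingForm p e) :
    B.ncard + 3 ≤ 2 * S.ncard := by
  classical
  have h1 := Subspace.finrank_add_finrank_dualCoannihilator_eq
    (span ℝ (Set.range fun e : B => bearingForm p e))
  rw [finrank_config, finrank_span_eq_card hind, ← Nat.card_eq_fintype_card,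
    Nat.card_coe_set_eq] at h1
  have h2 : LinearMap.range (similarityOn p S) ≤
      (span ℝ (Set.range fun e : B => bearingForm p e)).dualCoannihilator := by
    rw [← le_dualAnnihilator_iff_le_dualCoannihilator, span_le]
    rintro _ ⟨e, rfl⟩
    rw [SetLike.mem_coe, mem_dualAnnihilator]
    rintro _ ⟨x, rfl⟩
    obtain ⟨hs, ht⟩ := hB e e.2
    simp only [bearingForm_apply, similarityOn, LinearMap.coe_mk, AddHom.coe_mk, hs, ht,
      dite_true, add_sub_add_right_eq_sub, ← smul_sub, perp_smul, real_inner_smul_right]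
    rw [inner_perp]
    ring
  have h3 := finrank_mono h2
  have h4 := finrank_range_similarityOn hp hS
  omega

/-- The bearing constraints of an infinitesimally signed angle rigid framework have rank at least
`2 n - 3`. -/
theorem FrameworkISAR.two_mul_le_finrank_span {G : SimpleGraph (Fin n)} (hn : 3 ≤ n)
    {p : Config n} (hp : Function.Injective p) (h : FrameworkISAR G p) :
    2 * n ≤ finrank ℝ (span ℝ (Set.range fun e : G.edgeSet => bearingForm p e)) + 3 := by
  have h1 := Subspace.finrank_add_finrank_dualCoannihilator_eq
    (span ℝ (Set.range fun e : G.edgeSet => bearingForm p e))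
  rw [finrank_config] at h1
  set Q := (span ℝ (Set.range fun e : G.edgeSet => bearingForm p e)).dualCoannihilator with hQ
  have hout : ∀ e : G.edgeSet, G.Adj e.1.out.1 e.1.out.2 := fun e => by
    rw [← SimpleGraph.mem_edgeSet]
    have : s(e.1.out.1, e.1.out.2) = e.1 := Quot.out_eq e.1
    rw [this]
    exact e.2
  have hT : Q ≤ trivialMotions p := by
    intro u hu
    apply h
    have h0 : ∀ i j, G.Adj j i → angularVelocity p u j i = 0 := by
      intro i j hij
      have h2 : bearingForm p s(j, i) u = 0 :=
        (mem_dualCoannihilator _).mp hu _ (subset_span ⟨⟨s(j, i), hij⟩, rfl⟩)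
      rw [bearingForm_apply, neg_eq_zero] at h2
      have h3 : s((Quot.out s(j, i)).1, (Quot.out s(j, i)).2) = s(j, i) := Quot.out_eq s(j, i)
      rcases Sym2.eq_iff.mp h3 with ⟨h4, h5⟩ | ⟨h4, h5⟩
      · rw [h4, h5] at h2
        rw [angularVelocity_comm, angularVelocity_eq, h2, zero_div]
      · rw [h4, h5] at h2
        rw [angularVelocity_eq, h2, zero_div]
    rw [isInfinitesimalMotion_iff hp]
    intro i j k hi hk
    rw [h0 i j hi, h0 k j hk]
  have hT4 : finrank ℝ (trivialMotions p) ≤ 4 := by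
    have hspan : ∀ s : Set (Config n), s.Finite → finrank ℝ (span ℝ s) ≤ s.ncard := fun s hs => by
      have := hs.fintype
      rw [Set.ncard_eq_toFinset_card']
      exact finrank_span_le_card s
    have h2 := hspan {p} (Set.toFinite _)
    have h3 := hspan {fun i => perp (p i)} (Set.toFinite _)
    have h4 := (hspan {fun _ => !₂[1, 0], fun _ => !₂[0, 1]} (Set.toFinite _)).trans
      (Set.ncard_insert_le _ _)
    rw [Set.ncard_singleton] at h2 h3 h4
    have h5 := finrank_add_le_finrank_add_finrank
      (span ℝ ({p} : Set (Config n))) (span ℝ ({fun i => perp (p i)} : Set (Config n)))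
    have h6 := finrank_add_le_finrank_add_finrank
      (span ℝ ({p} : Set (Config n)) ⊔ span ℝ ({fun i => perp (p i)} : Set (Config n)))
      (span ℝ ({fun _ => !₂[1, 0], fun _ => !₂[0, 1]} : Set (Config n)))
    rw [trivialMotions]
    omega
  have hle := finrank_mono hT
  -- The rotation turns every edge, so a single edge excludes it from `Q` and lowers the bound 4 to
  -- 3. Without edges `Q` would have dimension `2n ≥ 6`, exceeding 4.
  by_cases hG : Nonempty G.edgeSet
  · obtain ⟨e⟩ := hG
    have hrot : (fun i => perp (p i)) ∈ trivialMotions p :=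
      mem_trivialMotions.mpr ⟨0, 1, 0, fun i => by simp⟩
    have hlt : Q < trivialMotions p := by
      refine lt_of_le_of_ne hT fun heq => ?_
      rw [← heq] at hrot
      have h2 : bearingForm p e (fun i => perp (p i)) = 0 :=
        (mem_dualCoannihilator _).mp hrot _ (subset_span ⟨e, rfl⟩)
      rw [bearingForm_apply, ← perp_sub, perp_perp, inner_neg_right, neg_neg,
        inner_self_eq_zero] at h2
      exact (hout e).ne (hp (sub_eq_zero.mp h2))
    have := finrank_lt_finrank_of_lt hlt
    omega
  · rw [not_nonempty_iff] at hG
    rw [Set.range_eq_empty, span_empty, finrank_bot] at h1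
    omega

/-- The edges of a basis of the bearing forms make up the Laman graph. Rigidity bounds their number
below; independence, applied to all vertices and to those of each subgraph, bounds it above. -/
theorem GraphISAR.exists_isLaman {G : SimpleGraph (Fin n)} (hn : 3 ≤ n) (h : GraphISAR G) :
    ∃ L ≤ G, IsLaman L := by
  obtain ⟨p, hp, hISAR⟩ := h
  have hrank := hISAR.two_mul_le_finrank_span hn hp
  obtain ⟨B, hBG, -, hspan, hind⟩ :=
    exists_linearIndepOn_extension (K := ℝ) (v := bearingForm p) (s := ∅) (t := G.edgeSet)
      (linearIndepOn_empty ℝ _) (Set.empty_subset _)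
  have hLB : (SimpleGraph.fromEdgeSet B).edgeSet = B := by
    rw [SimpleGraph.edgeSet_fromEdgeSet, sdiff_eq_left, Set.disjoint_left]
    intro e he
    exact G.not_isDiag_of_mem_edgeSet (hBG he)
  have hout : ∀ e : Sym2 (Fin n), s(e.out.1, e.out.2) = e := fun e => Quot.out_eq e
  have hlow : 2 * n ≤ B.ncard + 3 := by
    classical
    have h1 : finrank ℝ (span ℝ (bearingForm p '' B)) = B.ncard := by
      rw [Set.image_eq_range, finrank_span_eq_card hind, ← Nat.card_eq_fintype_card,
        Nat.card_coe_set_eq]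
    have h2 : span ℝ (Set.range fun e : G.edgeSet => bearingForm p e) ≤
        span ℝ (bearingForm p '' B) := by
      rw [span_le, ← Set.image_eq_range]
      exact hspan
    have h3 := finrank_mono h2
    omega
  have hup : B.ncard + 3 ≤ 2 * n := by
    have h1 : (Set.univ : Set (Fin n)).ncard = n := by
      rw [Set.ncard_univ, Nat.card_eq_fintype_card, Fintype.card_fin]
    have h2 := card_add_three_le_of_linearIndependent hp (S := Set.univ) (B := B) (by omega)
      (fun _ _ => ⟨trivial, trivial⟩) hind
    rwa [h1] at h2
  refine ⟨SimpleGraph.fromEdgeSet B, ?_, ?_, ?_, fun H hH => ?_⟩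
  · rw [← SimpleGraph.edgeSet_subset_edgeSet, hLB]
    exact hBG
  · rwa [Fintype.card_fin]
  · rw [hLB, Fintype.card_fin]
    omega
  · refine card_add_three_le_of_linearIndependent hp hH (fun e he => ?_)
      (hind.mono (H.edgeSet_subset.trans hLB.subset))
    rw [← hout e, SimpleGraph.Subgraph.mem_edgeSet] at he
    exact ⟨H.edge_vert he, H.edge_vert he.symm⟩

end SignedAngle

end

theorem theorem5 (n : ℕ) (hn : 3 ≤ n) (G : SimpleGraph (Fin n)) :
    SignedAngle.GraphISAR G ↔
      ∃ L : SimpleGraph (Fin n), SignedAngle.IsSpanningSubgraph L G ∧ SignedAngle.IsLaman L := by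
  constructor
  · intro h
    obtain ⟨L, hLG, hL⟩ := h.exists_isLaman hn
    exact ⟨L, ⟨hLG, hL.connected⟩, hL⟩
  · rintro ⟨L, ⟨hLG, -⟩, hL⟩
    exact hL.graphISAR hLG
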